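/- Let $p$ be an odd prime and $n\ge 1$, let $K$ be a field of characteristic zero containing a primitive $p^n$-th root of unity, and let $L/K$ be a cyclic Galois extension of degree $p^n$ with group $G=\langle\sigma\rangle$. Let $N=\langle\eta\rangle$ be a cyclic group of order $p^n$, and let $\delta$ be the $(p-1)$-st power of a generator of the cyclic group $\mathrm{Aut}(N)$. For $0\le r<p^{n-1}$ let $\beta_r:G\to \mathrm{Hol}(N)=\rho(N)\rtimes\mathrm{Aut}(N)\subseteq\mathrm{Perm}(N)$ be the homomorphism with $\beta_r(\sigma)=(\rho(\eta),\delta^r)$, i.e. $\beta_r(\sigma)$ is the permutation $x\mapsto\delta^r(x)\eta^{-1}$ of $N$. The map $b_r:G\to N$, $g\mapsto\beta_r(g)[1_N]$, is a bijection; let $\alpha_r:N\hookrightarrow\mathrm{Perm}(G)$ be the embedding corresponding to $\beta_r$ under Byott's translation, $\alpha_r(x)=b_r^{-1}\circ\lambda_N(x)\circ b_r$, where $\lambda_N(x)$ is left multiplication by $x$. The regular subgroup $\alpha_r(N)$ is normalized by the left translations $\lambda(g)$, $g\in G$. Let $$H_r=L[\alpha_r(N)]^G$$ be the $K$-algebra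 of fixed points of the group algebra $L[\alpha_r(N)]$ under the simultaneous action of $G$ on $L$ by Galois automorphisms and on $\alpha_r(N)$ by $g*\pi=\lambda(g)\pi\lambda(g)^{-1}$. For $0\le m\le n$ let $K_m=L^{\langle\sigma^{p^m}\rangle}$, the unique subfield of $L$ containing $K$ with $[K_m:K]=p^m$. Let $v_p(r)$ denote the $p$-adic valuation of $r$ if $r\neq 0$, and put $v_p(0)=n-1$. Then for every $0\le r<p^{n-1}$ there is an isomorphism of $K$-algebras $$H_r\;\cong\; K^{\,p^{1+v_p(r)}}\times\prod_{m=1}^{\,n-1-v_p(r)}\left(K_m\right)^{p^{v_p(r)}(p-1)} .$$ -/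

import Mathlib

open scoped MonoidAlgebra

noncomputable section

namespace CyclicHopfGalois

/-! ### Regular representations and the holomorph -/

/-- The left regular embedding `lam G : G → Perm G`, `lam G g : x ↦ g * x`. -/
def lam (G : Type*) [Group G] : G →* Equiv.Perm G := MulAction.toPermHom G G

/-- The right regular embedding `rho N : N → Perm N`, `rho N y : x ↦ x * y⁻¹`. -/
def rho (N : Type*) [Group N] : N →* Equiv.Perm N where
  toFun y := Equiv.mulRight y⁻¹
  map_one' := by ext x; simp
  map_mul' a b := by ext x; simp [mul_assoc]

/-- The holomorph of `N`: the normalizer of the image of the left regular embedding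
in `Perm N`. -/
def Hol (N : Type*) [Group N] : Subgroup (Equiv.Perm N) :=
  Subgroup.normalizer ((lam N).range : Set (Equiv.Perm N))

theorem mem_Hol_of {N : Type*} [Group N] (f : Equiv.Perm N) (ψ : N ≃* N)
    (h : ∀ x, f * lam N x * f⁻¹ = lam N (ψ x)) : f ∈ Hol N := by
  rw [Hol, Subgroup.mem_normalizer_iff]
  intro π
  constructor
  · rintro ⟨x, rfl⟩
    exact ⟨ψ x, (h x).symm⟩
  · rintro ⟨x, hx⟩
    refine ⟨ψ.symm x, ?_⟩
    have h1 := h (ψ.symm x)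
    rw [ψ.apply_symm_apply, hx] at h1
    simpa using h1

theorem rho_mem_Hol {N : Type*} [Group N] (y : N) : rho N y ∈ Hol N := by
  refine mem_Hol_of _ (MulEquiv.refl N) fun x => ?_
  ext z
  simp [rho, lam, Equiv.Perm.inv_def, mul_assoc]

theorem aut_mem_Hol {N : Type*} [Group N] (φ : MulAut N) : MulAut.toPerm N φ ∈ Hol N := by
  refine mem_Hol_of _ φ fun x => ?_
  rw [mul_inv_eq_iff_eq_mul]
  ext z
  exact map_mul φ x z

/-- The element `(rho y, φ)` of `Hol N = rho(N) ⋊ Aut N`, that is, the permutation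
`x ↦ φ x * y⁻¹` of `N`. -/
def holElt {N : Type*} [Group N] (y : N) (φ : MulAut N) : Hol N :=
  ⟨rho N y, rho_mem_Hol y⟩ * ⟨MulAut.toPerm N φ, aut_mem_Hol φ⟩

theorem holElt_apply {N : Type*} [Group N] (y : N) (φ : MulAut N) (x : N) :
    (holElt y φ : Equiv.Perm N) x = φ x * y⁻¹ := rfl

/-! ### Byott's translation -/

/-- The bijection `G → N`, `g ↦ β g 1`, attached to a regular embedding `β : G → Hol N`. -/
def orbitEquiv {G N : Type*} [Group G] [Group N] (β : G →* Hol N)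
    (hβ : Function.Bijective fun g : G => (β g : Equiv.Perm N) 1) : G ≃ N :=
  Equiv.ofBijective _ hβ

/-- Byott's translation: the embedding `α : N → Perm G` corresponding to a regular embedding
`β : G → Hol N`. With `b : G ≃ N`, `b g = β g 1`, it is `α x = b⁻¹ ∘ lam x ∘ b`. -/
def translate {G N : Type*} [Group G] [Group N] (β : G →* Hol N)
    (hβ : Function.Bijective fun g : G => (β g : Equiv.Perm N) 1) : N →* Equiv.Perm G :=
  ((orbitEquiv β hβ).symm.permCongrHom : Equiv.Perm N →* Equiv.Perm G).comp (lam N)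

theorem translate_stable {G N : Type*} [Group G] [Group N] (β : G →* Hol N)
    (hβ : Function.Bijective fun g : G => (β g : Equiv.Perm N) 1) (g : G) :
    lam G g ∈ Subgroup.normalizer ((translate β hβ).range : Set (Equiv.Perm G)) := by
  have h1 : (translate β hβ).range = (lam N).range.map
      ((orbitEquiv β hβ).symm.permCongrHom : Equiv.Perm N →* Equiv.Perm G) := by
    rw [translate, MonoidHom.range_comp]
  have h2 : lam G g = (orbitEquiv β hβ).symm.permCongrHom (β g : Equiv.Perm N) := by
    ext h
    apply (orbitEquiv β hβ).injective
    simp [lam, Equiv.permCongrHom, Equiv.permCongr_apply, orbitEquiv]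
  have h3 := Subgroup.map_equiv_normalizer_eq (lam N).range (orbitEquiv β hβ).symm.permCongrHom
  rw [h1, h2]
  exact h3.le ⟨_, (β g).2, rfl⟩

/-! ### The Hopf algebra attached to a `G`-stable subgroup of `Perm G` -/

/-- Let the group `Gal(L/K)` act on a group `M` by automorphisms through `φ`. This is the
`K`-algebra automorphism `∑ c_m m ↦ ∑ g(c_m) φ_g(m)` of `L[M]` given by `g`. -/
def galAct (K L : Type*) [Field K] [Field L] [Algebra K L] {M : Type*} [Group M]
    (φ : Gal(L/K) →* MulAut M) (g : Gal(L/K)) : L[M] →ₐ[K] L[M] :=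
  (MonoidAlgebra.mapDomainAlgHom K L (φ g : M →* M)).comp
    (MonoidAlgebra.mapAlgHom M (g : L →ₐ[K] L))

/-- The `K`-algebra `L[M]^G` of fixed points of `G = Gal(L/K)` acting on the group algebra
`L[M]` through its Galois action on `L` and through `φ` on `M`. -/
def fixedPoints (K L : Type*) [Field K] [Field L] [Algebra K L] {M : Type*} [Group M]
    (φ : Gal(L/K) →* MulAut M) : Subalgebra K L[M] :=
  ⨅ g : Gal(L/K), AlgHom.equalizer (galAct K L φ g) (AlgHom.id K L[M])

/-- The conjugation action `g ∗ π = lam g * π * (lam g)⁻¹` of `G` on a subgroup `M` of `Perm G`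
that is normalized by `lam G`. -/
def conjAct {G : Type*} [Group G] (M : Subgroup (Equiv.Perm G))
    (hM : ∀ g, lam G g ∈ Subgroup.normalizer (M : Set (Equiv.Perm G))) : G →* MulAut M :=
  M.normalizerMonoidHom.comp ((lam G).codRestrict _ hM)

/-- The algebra `L[M]^G` of Greither and Pareigis, for `G = Gal(L/K)` and a subgroup `M` of
`Perm G` normalized by `lam G`. -/
def hopfAlg (K L : Type*) [Field K] [Field L] [Algebra K L]
    (M : Subgroup (Equiv.Perm Gal(L/K)))
    (hM : ∀ g, lam Gal(L/K) g ∈ Subgroup.normalizer (M : Set (Equiv.Perm Gal(L/K)))) :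
    Subalgebra K L[M] :=
  fixedPoints K L (conjAct M hM)

/-! ### The embeddings for cyclic groups of odd prime power order -/

theorem dvd_geom_sum_iff {p : ℕ} (hp : p.Prime) (hp2 : p ≠ 2) (n k : ℕ) (d : ℤ)
    (hd : (p : ℤ) ∣ d - 1) :
    ((p ^ n : ℕ) : ℤ) ∣ ∑ i ∈ Finset.range k, d ^ i ↔ p ^ n ∣ k := by
  by_cases h1 : d = 1
  · subst h1
    simp only [one_pow, Finset.sum_const, Finset.card_range, nsmul_eq_mul, mul_one]
    exact Int.natCast_dvd_natCast
  · have hpd : ¬ (p : ℤ) ∣ d := fun h => by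
      have h3 : (p : ℤ) ∣ 1 := by simpa using dvd_sub h hd
      have h4 : p ∣ 1 := by exact_mod_cast h3
      exact hp.one_lt.ne' (Nat.dvd_one.mp h4)
    have h2 := Int.emultiplicity_pow_sub_pow hp (hp.odd_of_ne_two hp2) hd hpd k
    rw [one_pow, ← geom_sum_mul, emultiplicity_mul (Nat.prime_iff_prime_int.mp hp),
      add_comm] at h2
    have hfin : FiniteMultiplicity (p : ℤ) (d - 1) := by
      rw [Int.finiteMultiplicity_iff]
      exact ⟨by simpa using hp.one_lt.ne', sub_ne_zero.mpr h1⟩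
    have h3 := (WithTop.add_left_inj (finiteMultiplicity_iff_emultiplicity_ne_top.mp hfin)).mp h2
    rw [Nat.cast_pow, pow_dvd_iff_le_emultiplicity, h3, ← pow_dvd_iff_le_emultiplicity]

theorem aut_pow_gen {N : Type*} [Group N] {p n : ℕ} (hp : p.Prime) (hn : 1 ≤ n) {η : N}
    (hη : ∀ x : N, x ∈ Subgroup.zpowers η) (hN : Nat.card N = p ^ n) (θ : MulAut N) (r : ℕ) :
    ∃ d : ℤ, (p : ℤ) ∣ d - 1 ∧ ((θ ^ (p - 1)) ^ r) η = η ^ d := by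
  obtain ⟨t, ht⟩ := Subgroup.mem_zpowers_iff.mp (hη (θ η))
  have hord : orderOf η = p ^ n := by rw [orderOf_eq_card_of_forall_mem_zpowers hη, hN]
  have hpow : ∀ j : ℕ, (θ ^ j) η = η ^ (t ^ j) := by
    intro j
    induction j with
    | zero => simp
    | succ j ih =>
      rw [pow_succ', MulAut.mul_apply, ih, map_zpow, ← ht, ← zpow_mul, pow_succ']
  have hpt : ¬ (p : ℤ) ∣ t := by
    rintro ⟨u, rfl⟩
    have h1 : (θ η) ^ (p ^ (n - 1)) = 1 := by
      rw [← ht, ← zpow_natCast, ← zpow_mul]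
      have h2 : (p : ℤ) * u * ((p ^ (n - 1) : ℕ) : ℤ) = ((p ^ n : ℕ) : ℤ) * u := by
        obtain ⟨m, rfl⟩ := Nat.exists_eq_add_of_le' hn
        push_cast
        ring
      rw [h2, zpow_mul, zpow_natCast, ← hord, pow_orderOf_eq_one, one_zpow]
    rw [← map_pow, map_eq_one_iff θ θ.injective] at h1
    have h3 := orderOf_dvd_of_pow_eq_one h1
    rw [hord, Nat.pow_dvd_pow_iff_le_right hp.one_lt] at h3
    omega
  refine ⟨t ^ ((p - 1) * r), ?_, by rw [← pow_mul, hpow]⟩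
  have hc : IsCoprime t (p : ℤ) :=
    ((Nat.prime_iff_prime_int.mp hp).coprime_iff_not_dvd.mpr hpt).symm
  have h4 : t ^ (p - 1) ≡ 1 [ZMOD p] := Int.ModEq.pow_card_sub_one_eq_one hp hc
  have h5 := (h4.pow r).symm.dvd
  rwa [one_pow, ← pow_mul] at h5

theorem holElt_pow_apply {N : Type*} [Group N] (η : N) (φ : MulAut N) (d : ℤ)
    (hd : φ η = η ^ d) (k : ℕ) (a : ℤ) :
    ((holElt η φ ^ k : Hol N) : Equiv.Perm N) (η ^ a) =
      η ^ (d ^ k * a - ∑ i ∈ Finset.range k, d ^ i) := by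
  induction k with
  | zero => simp
  | succ k ih =>
    have h1 : ((holElt η φ ^ (k + 1) : Hol N) : Equiv.Perm N) (η ^ a) =
        (holElt η φ : Equiv.Perm N) (((holElt η φ ^ k : Hol N) : Equiv.Perm N) (η ^ a)) := by
      rw [pow_succ']; rfl
    rw [h1, ih, holElt_apply, map_zpow, hd, ← zpow_mul, ← zpow_sub_one, geom_sum_succ]
    congr 1
    ring

theorem holElt_pow_eq_one {N : Type*} [Group N] {p n : ℕ} (hp : p.Prime) (hp2 : p ≠ 2)
    (hn : 1 ≤ n) {η : N} (hη : ∀ x : N, x ∈ Subgroup.zpowers η) (hN : Nat.card N = p ^ n)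
    (θ : MulAut N) (r : ℕ) : holElt η ((θ ^ (p - 1)) ^ r) ^ (p ^ n) = 1 := by
  obtain ⟨d, hd1, hd2⟩ := aut_pow_gen hp hn hη hN θ r
  have hord : orderOf η = p ^ n := by rw [orderOf_eq_card_of_forall_mem_zpowers hη, hN]
  have hS := (dvd_geom_sum_iff hp hp2 n (p ^ n) d hd1).mpr dvd_rfl
  have hD : ((p ^ n : ℕ) : ℤ) ∣ d ^ (p ^ n) - 1 := by
    rw [← geom_sum_mul]; exact hS.mul_right _
  apply Subtype.ext
  ext x
  obtain ⟨a, rfl⟩ := Subgroup.mem_zpowers_iff.mp (hη x)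
  rw [holElt_pow_apply η _ d hd2, OneMemClass.coe_one, Equiv.Perm.one_apply,
    zpow_eq_zpow_iff_modEq, hord]
  apply Int.ModEq.symm
  rw [Int.modEq_iff_dvd]
  have h : d ^ p ^ n * a - ∑ i ∈ Finset.range (p ^ n), d ^ i - a =
      (d ^ p ^ n - 1) * a - ∑ i ∈ Finset.range (p ^ n), d ^ i := by ring
  rw [h]
  exact dvd_sub (hD.mul_right _) hS

/-- Let `G = ⟨σ⟩` and `N = ⟨η⟩` be cyclic of order `p ^ n` with `p` an odd prime, `θ` an
automorphism of `N` and `δ = θ ^ (p - 1)`. This is the homomorphism `β_r : G → Hol N` with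
`β_r σ = (rho η, δ ^ r)`. -/
def beta {G N : Type*} [Group G] [Group N] {p n : ℕ} (hp : p.Prime) (hp2 : p ≠ 2) (hn : 1 ≤ n)
    {σ : G} (hσ : ∀ g : G, g ∈ Subgroup.zpowers σ) (hG : Nat.card G = p ^ n)
    {η : N} (hη : ∀ x : N, x ∈ Subgroup.zpowers η) (hN : Nat.card N = p ^ n)
    (θ : MulAut N) (r : ℕ) : G →* Hol N :=
  monoidHomOfForallMemZpowers (g' := holElt η ((θ ^ (p - 1)) ^ r)) hσ
    (by
      rw [orderOf_eq_card_of_forall_mem_zpowers hσ, hG]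
      exact orderOf_dvd_of_pow_eq_one (holElt_pow_eq_one hp hp2 hn hη hN θ r))

theorem beta_gen {G N : Type*} [Group G] [Group N] {p n : ℕ} (hp : p.Prime) (hp2 : p ≠ 2)
    (hn : 1 ≤ n) {σ : G} (hσ : ∀ g : G, g ∈ Subgroup.zpowers σ) (hG : Nat.card G = p ^ n)
    {η : N} (hη : ∀ x : N, x ∈ Subgroup.zpowers η) (hN : Nat.card N = p ^ n)
    (θ : MulAut N) (r : ℕ) :
    beta hp hp2 hn hσ hG hη hN θ r σ = holElt η ((θ ^ (p - 1)) ^ r) :=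
  monoidHomOfForallMemZpowers_apply_gen hσ _

theorem beta_regular {G N : Type*} [Group G] [Group N] {p n : ℕ} (hp : p.Prime) (hp2 : p ≠ 2)
    (hn : 1 ≤ n) {σ : G} (hσ : ∀ g : G, g ∈ Subgroup.zpowers σ) (hG : Nat.card G = p ^ n)
    {η : N} (hη : ∀ x : N, x ∈ Subgroup.zpowers η) (hN : Nat.card N = p ^ n)
    (θ : MulAut N) (r : ℕ) :
    Function.Bijective fun g : G =>
      (beta hp hp2 hn hσ hG hη hN θ r g : Equiv.Perm N) 1 := by
  set β := beta hp hp2 hn hσ hG hη hN θ r with hβ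
  have hpos : 0 < p ^ n := pow_pos hp.pos n
  have : Finite G := Nat.finite_of_card_ne_zero (by omega)
  have : Finite N := Nat.finite_of_card_ne_zero (by omega)
  obtain ⟨d, hd1, hd2⟩ := aut_pow_gen hp hn hη hN θ r
  have hordη : orderOf η = p ^ n := by rw [orderOf_eq_card_of_forall_mem_zpowers hη, hN]
  have hordσ : orderOf σ = p ^ n := by rw [orderOf_eq_card_of_forall_mem_zpowers hσ, hG]
  have key : ∀ g : G, (β g : Equiv.Perm N) 1 = 1 → g = 1 := by
    intro g hg
    obtain ⟨k, rfl⟩ := (Submonoid.mem_powers_iff _ _).mp (mem_powers_iff_mem_zpowers.mpr (hσ g))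
    rw [map_pow, hβ, beta_gen] at hg
    have h1 := holElt_pow_apply η _ d hd2 k 0
    rw [zpow_zero, hg, mul_zero, zero_sub, zpow_neg, eq_comm, inv_eq_one,
      ← orderOf_dvd_iff_zpow_eq_one, hordη, dvd_geom_sum_iff hp hp2 n k d hd1] at h1
    rw [← orderOf_dvd_iff_pow_eq_one, hordσ]
    exact h1
  refine (Nat.bijective_iff_injective_and_card _).mpr ⟨?_, by rw [hG, hN]⟩
  intro g h hgh
  have h1 : (β (h⁻¹ * g) : Equiv.Perm N) 1 = 1 := by
    have h2 : (β g : Equiv.Perm N) 1 = (β h : Equiv.Perm N) 1 := hgh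
    rw [map_mul, map_inv, Subgroup.coe_mul, Equiv.Perm.mul_apply, h2, Subgroup.coe_inv,
      Equiv.Perm.inv_def, Equiv.symm_apply_apply]
  exact (inv_mul_eq_one.mp (key _ h1)).symm

/-- The embedding `α_r : N → Perm G` corresponding to `β_r` under Byott's translation. -/
def alpha {G N : Type*} [Group G] [Group N] {p n : ℕ} (hp : p.Prime) (hp2 : p ≠ 2) (hn : 1 ≤ n)
    {σ : G} (hσ : ∀ g : G, g ∈ Subgroup.zpowers σ) (hG : Nat.card G = p ^ n)
    {η : N} (hη : ∀ x : N, x ∈ Subgroup.zpowers η) (hN : Nat.card N = p ^ n)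
    (θ : MulAut N) (r : ℕ) : N →* Equiv.Perm G :=
  translate (beta hp hp2 hn hσ hG hη hN θ r) (beta_regular hp hp2 hn hσ hG hη hN θ r)

/-- The algebra `H_r = L[α_r(N)]^G`, where `G = Gal(L/K) = ⟨σ⟩`. -/
abbrev hopfAlgCyclic (K L : Type*) [Field K] [Field L] [Algebra K L] {N : Type*} [Group N]
    {p n : ℕ} (hp : p.Prime) (hp2 : p ≠ 2) (hn : 1 ≤ n)
    {σ : Gal(L/K)} (hσ : ∀ g : Gal(L/K), g ∈ Subgroup.zpowers σ)
    (hG : Nat.card Gal(L/K) = p ^ n)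
    {η : N} (hη : ∀ x : N, x ∈ Subgroup.zpowers η) (hN : Nat.card N = p ^ n)
    (θ : MulAut N) (r : ℕ) : Subalgebra K L[(alpha hp hp2 hn hσ hG hη hN θ r).range] :=
  hopfAlg K L (alpha hp hp2 hn hσ hG hη hN θ r).range
    (translate_stable (beta hp hp2 hn hσ hG hη hN θ r) (beta_regular hp hp2 hn hσ hG hη hN θ r))

/-! ### The tower of intermediate fields and the valuation of `r` -/

/-- The field `K_m`: the fixed field of `⟨σ ^ (p ^ m)⟩`. If `Gal(L/K) = ⟨σ⟩` has order `p ^ n`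
and `m ≤ n`, it is the unique intermediate field of degree `p ^ m` over `K`. -/
abbrev tower {K L : Type*} [Field K] [Field L] [Algebra K L] (p : ℕ) (σ : Gal(L/K)) (m : ℕ) :
    IntermediateField K L :=
  IntermediateField.fixedField (Subgroup.zpowers (σ ^ (p ^ m)))

theorem finrank_tower {K L : Type*} [Field K] [Field L] [Algebra K L] [FiniteDimensional K L]
    [IsGalois K L] {p n : ℕ} (hp : p.Prime) (hL : Module.finrank K L = p ^ n) {σ : Gal(L/K)}
    (hσ : ∀ g : Gal(L/K), g ∈ Subgroup.zpowers σ) {m : ℕ} (hm : m ≤ n) :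
    Module.finrank K (tower p σ m) = p ^ m := by
  have hord : orderOf σ = p ^ n := by
    rw [orderOf_eq_card_of_forall_mem_zpowers hσ, IsGalois.card_aut_eq_finrank, hL]
  have h1 : Module.finrank (tower p σ m) L = p ^ (n - m) := by
    rw [IntermediateField.finrank_fixedField_eq_card, Nat.card_zpowers,
      orderOf_pow_of_dvd (pow_pos hp.pos m).ne' (hord ▸ pow_dvd_pow p hm), hord,
      Nat.pow_div hm hp.pos]
  have h2 := Module.finrank_mul_finrank K (tower p σ m) L
  rw [h1, hL] at h2
  refine Nat.eq_of_mul_eq_mul_right (pow_pos hp.pos (n - m)) ?_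
  rw [h2, ← pow_add, Nat.add_sub_cancel' hm]

/-- The `p`-adic valuation of an index `0 ≤ r < p ^ (n - 1)`; the index `0`, which plays the role
of `p ^ (n - 1)`, has valuation `n - 1`. -/
def val (p n r : ℕ) : ℕ := if r = 0 then n - 1 else padicValNat p r

end CyclicHopfGalois

end

/-!
As `K` contains enough roots of unity, the Fourier transform identifies `L[M]`, for `M = α_r(N)`,
with the functions on the dual group of `M`, and `L[M]^G` with the `G`-equivariant ones. Such a
function is determined by its values at representatives of the `G`-orbits of characters, the value
at `χ` being an arbitrary element of the fixed field of the stabilizer of `χ`. An orbit of size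
`p ^ m` has stabilizer `⟨σ ^ (p ^ m)⟩`, so it contributes a factor `K_m`.

It remains to count orbits of each size. The generator `σ` acts on `M`, hence up to inversion on
the characters, by raising to a power `d`, where `d - 1` has `p`-adic valuation `1 + v_p(r)` as far
as can be seen modulo `p ^ n`. Lifting the exponent shows that the orbit of `χ` has as many
elements as the order of `χ ^ (p ^ (1 + v_p(r)))`, and elements of given order in a cyclic group
are counted by Euler's totient function.
-/

namespace CyclicHopfGalois

/-- The `K`-algebra of `Gal(L/K)`-equivariant functions on a `Gal(L/K)`-set with values in `L`. -/
def equivariantFunctions (K L X : Type*) [Field K] [Field L] [Algebra K L]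
    [MulAction Gal(L/K) X] : Subalgebra K (X → L) where
  carrier := {f | ∀ (g : Gal(L/K)) (x : X), f (g • x) = g (f x)}
  mul_mem' := fun ha hb g x => by simp [ha g x, hb g x]
  add_mem' := fun ha hb g x => by simp [ha g x, hb g x]
  algebraMap_mem' := fun c g x => by simp

section EquivariantFunctions

open MulAction IntermediateField

variable {K L X : Type*} [Field K] [Field L] [Algebra K L] [MulAction Gal(L/K) X]

theorem mem_equivariantFunctions {f : X → L} :
    f ∈ equivariantFunctions K L X ↔ ∀ (g : Gal(L/K)) (x : X), f (g • x) = g (f x) := Iff.rfl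

theorem apply_mem_fixedField_stabilizer {f : X → L} (hf : f ∈ equivariantFunctions K L X) (x : X) :
    f x ∈ fixedField (stabilizer Gal(L/K) x) := by
  rw [mem_fixedField_iff]
  intro g hg
  rw [← hf g, mem_stabilizer_iff.mp hg]

theorem apply_eq_apply_of_mem_fixedField_stabilizer {x : X} {a : L}
    (ha : a ∈ fixedField (stabilizer Gal(L/K) x)) {g h : Gal(L/K)} (hgh : g • x = h • x) :
    g a = h a := by
  have hstab : h⁻¹ * g ∈ stabilizer Gal(L/K) x := by
    rw [mem_stabilizer_iff, mul_smul, hgh, inv_smul_smul]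
  have hfix := congrArg h ((mem_fixedField_iff _ _).mp ha _ hstab)
  rwa [← AlgEquiv.mul_apply, mul_inv_cancel_left] at hfix

theorem exists_smul_out_eq (x : X) :
    ∃ g : Gal(L/K), g • Quotient.out (Quotient.mk'' x : orbitRel.Quotient Gal(L/K) X) = x :=
  mem_orbit_symm.mp (orbitRel_apply.mp (Quotient.mk_out (s := orbitRel Gal(L/K) X) x))

theorem exists_equivariant_extension
    (a : ∀ ω : orbitRel.Quotient Gal(L/K) X, fixedField (stabilizer Gal(L/K) (Quotient.out ω))) :
    ∃ f ∈ equivariantFunctions K L X, ∀ ω, f (Quotient.out ω) = a ω := by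
  choose s hs using exists_smul_out_eq (K := K) (L := L) (X := X)
  have value_eq : ∀ (ω : orbitRel.Quotient Gal(L/K) X) (g : Gal(L/K)) (x : X),
      g • Quotient.out ω = x → s x (a (Quotient.mk'' x)) = g (a ω) := by
    intro ω g x hgx
    obtain rfl : (Quotient.mk'' x : orbitRel.Quotient Gal(L/K) X) = ω := by
      rw [← hgx]
      exact (orbitRel.Quotient.quotient_smul_eq ..).trans (Quotient.out_eq ω)
    exact apply_eq_apply_of_mem_fixedField_stabilizer (a _).2 ((hs x).trans hgx.symm)
  refine ⟨fun x => s x (a (Quotient.mk'' x)), fun g x => ?_, fun ω => ?_⟩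
  · exact value_eq _ (g * s x) _ (by rw [mul_smul, hs])
  · exact value_eq ω 1 _ (one_smul _ _)

theorem eq_of_forall_apply_out_eq {f f' : X → L} (hf : f ∈ equivariantFunctions K L X)
    (hf' : f' ∈ equivariantFunctions K L X)
    (h : ∀ ω : orbitRel.Quotient Gal(L/K) X, f (Quotient.out ω) = f' (Quotient.out ω)) :
    f = f' := by
  ext x
  obtain ⟨g, hg⟩ := exists_smul_out_eq (K := K) (L := L) x
  rw [← hg, hf, hf', h]

variable (K L X) in
/-- Evaluation of equivariant functions at the chosen representatives `Quotient.out ω` of the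
orbits; the value at a point is an arbitrary element fixed by its stabilizer. -/
noncomputable def equivariantFunctionsEquiv : equivariantFunctions K L X ≃ₐ[K]
    ∀ ω : orbitRel.Quotient Gal(L/K) X, fixedField (stabilizer Gal(L/K) (Quotient.out ω)) :=
  AlgEquiv.ofBijective
    (AlgHom.pi fun ω =>
      ((Pi.evalAlgHom K (fun _ : X => L) (Quotient.out ω)).comp
        (equivariantFunctions K L X).val).codRestrict
          (fixedField (stabilizer Gal(L/K) (Quotient.out ω))).toSubalgebra
          fun f => apply_mem_fixedField_stabilizer f.2 _)
    ⟨fun f f' h => Subtype.ext <| eq_of_forall_apply_out_eq f.2 f'.2 fun ω =>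
        congrArg Subtype.val (congrFun h ω),
      fun a => by
        obtain ⟨f, hf, hfa⟩ := exists_equivariant_extension a
        exact ⟨⟨f, hf⟩, funext fun ω => Subtype.ext (hfa ω)⟩⟩

end EquivariantFunctions

theorem exists_sum_sigma_equiv {Ω α : Type*} [Finite Ω] (m : Ω → α) {ℓ : ℕ → α}
    (hℓ : Function.Injective ℓ) {T A B : ℕ} (hm : ∀ ω, ∃ j ≤ T, m ω = ℓ j)
    (hA : Nat.card {ω // m ω = ℓ 0} = A)
    (hB : ∀ j ∈ Finset.Icc 1 T, Nat.card {ω // m ω = ℓ j} = B) :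
    ∃ e : Fin A ⊕ (Σ _ : Finset.Icc 1 T, Fin B) ≃ Ω,
      (∀ i, m (e (Sum.inl i)) = ℓ 0) ∧ ∀ x, m (e (Sum.inr x)) = ℓ x.1 := by
  let e₀ : {ω // m ω = ℓ 0} ≃ Fin A := Finite.equivFinOfCardEq hA
  let e₁ (j : Finset.Icc 1 T) : {ω // m ω = ℓ j} ≃ Fin B := Finite.equivFinOfCardEq (hB j j.2)
  let f : Fin A ⊕ (Σ _ : Finset.Icc 1 T, Fin B) → Ω :=
    Sum.elim (fun i => (e₀.symm i).1) fun x => ((e₁ x.1).symm x.2).1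
  have m_inl (i : Fin A) : m (f (Sum.inl i)) = ℓ 0 := (e₀.symm i).2
  have m_inr (x : Σ _ : Finset.Icc 1 T, Fin B) : m (f (Sum.inr x)) = ℓ x.1 :=
    ((e₁ x.1).symm x.2).2
  have f_injective : Function.Injective f := by
    refine Function.Injective.sumElim (Subtype.val_injective.comp e₀.symm.injective) ?_ ?_
    · rintro ⟨j, i⟩ ⟨j', i'⟩ h
      obtain rfl : j = j' := Subtype.ext <| hℓ <|
        (m_inr ⟨j, i⟩).symm.trans ((congrArg m h).trans (m_inr ⟨j', i'⟩))
      obtain rfl : i = i' := (e₁ j).symm.injective (Subtype.ext h)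
      rfl
    · intro i x h
      have h_zero : 0 = (x.1 : ℕ) := hℓ ((m_inl i).symm.trans ((congrArg m h).trans (m_inr x)))
      exact (Finset.mem_Icc.mp x.1.2).1.not_gt (h_zero ▸ one_pos)
  have f_surjective : Function.Surjective f := by
    intro ω
    obtain ⟨j, hjT, hj⟩ := hm ω
    rcases Nat.eq_zero_or_pos j with rfl | hj_pos
    · exact ⟨Sum.inl (e₀ ⟨ω, hj⟩), congrArg Subtype.val (e₀.symm_apply_apply _)⟩
    · exact ⟨Sum.inr ⟨⟨j, Finset.mem_Icc.mpr ⟨hj_pos, hjT⟩⟩, e₁ _ ⟨ω, hj⟩⟩,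
        congrArg Subtype.val ((e₁ _).symm_apply_apply _)⟩
  exact ⟨Equiv.ofBijective f ⟨f_injective, f_surjective⟩, m_inl, m_inr⟩

/-- A product indexed by `S ⊕ Σ t, U t` as a pair of an indexed and a doubly indexed product. -/
def piSumSigmaEquiv (R : Type*) {S T : Type*} {U : T → Type*} [CommSemiring R]
    (F : S ⊕ (Σ t, U t) → Type*) [∀ i, Semiring (F i)] [∀ i, Algebra R (F i)] :
    (∀ i, F i) ≃ₐ[R] (∀ s, F (Sum.inl s)) × ∀ t u, F (Sum.inr ⟨t, u⟩) :=
  AlgEquiv.ofLinearEquiv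
    ((LinearEquiv.sumPiEquivProdPi R S _ F).trans <|
      (LinearEquiv.refl R _).prodCongr (LinearEquiv.piCurry R fun t u => F (Sum.inr ⟨t, u⟩)))
    rfl fun _ _ => rfl

section Orbits

open MulAction

variable {G X : Type*} [Group G] [MulAction G X]

theorem card_orbits_of_card_eq_mul [Finite X] (l : ℕ) :
    Nat.card {ω : orbitRel.Quotient G X // Nat.card (orbit G (Quotient.out ω)) = l} * l =
      Nat.card {x : X // Nat.card (orbit G x) = l} := by
  have card_orbit_eq (x : X) : Nat.card (orbit G x) =
      Nat.card (orbit G (Quotient.out (selfEquivSigmaOrbits G X x).1)) := by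
    have x_mem : x ∈ orbit G (Quotient.out (selfEquivSigmaOrbits G X x).1) :=
      (selfEquivSigmaOrbits G X x).2.2
    rw [orbit_eq_iff.mpr x_mem]
  let e : {x : X // Nat.card (orbit G x) = l} ≃
      Σ ω : {ω : orbitRel.Quotient G X // Nat.card (orbit G (Quotient.out ω)) = l},
        orbit G (Quotient.out ω.1) :=
    ((selfEquivSigmaOrbits G X).subtypeEquiv fun x => by rw [card_orbit_eq]).trans
      (Equiv.subtypeSigmaEquiv _ fun ω => Nat.card (orbit G (Quotient.out ω)) = l)
  have := Fintype.ofFinite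
    {ω : orbitRel.Quotient G X // Nat.card (orbit G (Quotient.out ω)) = l}
  rw [Nat.card_congr e, Nat.card_sigma, Finset.sum_congr rfl fun ω _ => ω.2, Finset.sum_const,
    Finset.card_univ, smul_eq_mul, Nat.card_eq_fintype_card]

variable {σ : G}

theorem stabilizer_eq_zpowers_pow_period (hσ : ∀ g : G, g ∈ Subgroup.zpowers σ) (x : X) :
    stabilizer G x = Subgroup.zpowers (σ ^ period σ x) := by
  apply le_antisymm
  · intro g hg
    obtain ⟨k, rfl⟩ := Subgroup.mem_zpowers_iff.mp (hσ g)
    obtain ⟨c, rfl⟩ := zpow_smul_eq_iff_period_dvd.mp (mem_stabilizer_iff.mp hg)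
    exact Subgroup.mem_zpowers_iff.mpr ⟨c, by rw [zpow_mul, zpow_natCast]⟩
  · rw [Subgroup.zpowers_le, mem_stabilizer_iff, pow_period_smul]

theorem card_orbit_eq_period (hσ : ∀ g : G, g ∈ Subgroup.zpowers σ) (x : X) :
    Nat.card (orbit G x) = period σ x := by
  have h_orbit : orbit G x = orbit (Subgroup.zpowers σ) x :=
    Set.Subset.antisymm (fun _ ⟨g, hg⟩ => ⟨⟨g, hσ g⟩, hg⟩) fun _ ⟨g, hg⟩ => ⟨g, hg⟩
  rw [h_orbit]
  exact Nat.card_congr (orbitZPowersEquiv σ x) |>.trans (Nat.card_zmod _)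

end Orbits

theorem fixedField_zpowers_eq_bot {K L : Type*} [Field K] [Field L] [Algebra K L] [IsGalois K L]
    {σ : Gal(L/K)} (hσ : ∀ g : Gal(L/K), g ∈ Subgroup.zpowers σ) :
    IntermediateField.fixedField (Subgroup.zpowers σ) = ⊥ := by
  rw [(Subgroup.eq_top_iff' _).mpr hσ, InfiniteGalois.fixedField_bot]

theorem nonempty_equivariantFunctions_algEquiv_prod {K L X : Type*} [Field K] [Field L]
    [Algebra K L] [IsGalois K L] [MulAction Gal(L/K) X] [Finite X] {σ : Gal(L/K)}
    (hσ : ∀ g : Gal(L/K), g ∈ Subgroup.zpowers σ) {p T A B : ℕ} (hp : 1 < p)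
    (h_period : ∀ x : X, ∃ j ≤ T, MulAction.period σ x = p ^ j)
    (h_fixed : Nat.card {x : X // MulAction.period σ x = 1} = A)
    (h_moved : ∀ j ∈ Finset.Icc 1 T,
      Nat.card {x : X // MulAction.period σ x = p ^ j} = B * p ^ j) :
    Nonempty (equivariantFunctions K L X ≃ₐ[K]
      ((Fin A → K) × ((j : Finset.Icc 1 T) → (Fin B → tower p σ (j : ℕ))))) := by
  have card_orbits (l : ℕ) : Nat.card {ω : MulAction.orbitRel.Quotient Gal(L/K) X //
      MulAction.period σ (Quotient.out ω) = l} * l =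
        Nat.card {x : X // MulAction.period σ x = l} := by
    simpa only [card_orbit_eq_period hσ] using
      card_orbits_of_card_eq_mul (G := Gal(L/K)) (X := X) l
  obtain ⟨e, he_inl, he_inr⟩ := exists_sum_sigma_equiv
    (fun ω : MulAction.orbitRel.Quotient Gal(L/K) X => MulAction.period σ (Quotient.out ω))
    (Nat.pow_right_injective hp) (A := A) (B := B) (fun ω => h_period _)
    (by simpa [h_fixed] using card_orbits 1)
    fun j hj => Nat.eq_of_mul_eq_mul_right (pow_pos (zero_lt_one.trans hp) j)
      ((card_orbits _).trans (h_moved j hj))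
  let F (i : Fin A ⊕ (Σ _ : Finset.Icc 1 T, Fin B)) : IntermediateField K L :=
    IntermediateField.fixedField (MulAction.stabilizer Gal(L/K) (Quotient.out (e i)))
  have hF_inl (i : Fin A) : F (Sum.inl i) = ⊥ := by
    simp only [F, stabilizer_eq_zpowers_pow_period hσ, he_inl]
    rw [pow_zero, pow_one, fixedField_zpowers_eq_bot hσ]
  have hF_inr (j : Finset.Icc 1 T) (i : Fin B) : F (Sum.inr ⟨j, i⟩) = tower p σ j := by
    simp only [F, stabilizer_eq_zpowers_pow_period hσ, he_inr]
  exact ⟨(equivariantFunctionsEquiv K L X).trans <|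
    (AlgEquiv.piCongrLeft K _ e).symm.trans <|
    (piSumSigmaEquiv K fun i => F i).trans <|
    (AlgEquiv.piCongrRight fun i => (IntermediateField.equivOfEq (hF_inl i)).trans
        (IntermediateField.botEquiv K L)).prodCongr <|
      AlgEquiv.piCongrRight fun j => AlgEquiv.piCongrRight fun i =>
        IntermediateField.equivOfEq (hF_inr j i)⟩

/-- The action of `G` on the characters of a group on which it acts through `φ`: an element `g`
sends `χ` to `χ ∘ φ g⁻¹`. -/
abbrev characterAction {G M A : Type*} [Group G] [Group M] [Monoid A] (φ : G →* MulAut M) :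
    MulAction G (M →* A) where
  smul g χ := χ.comp (φ g⁻¹ : M →* M)
  one_smul χ := MonoidHom.ext fun y => show χ (φ 1⁻¹ y) = χ y by simp
  mul_smul g h χ := MonoidHom.ext fun y =>
    show χ (φ (g * h)⁻¹ y) = χ (φ h⁻¹ (φ g⁻¹ y)) by simp

theorem characterAction_smul_comp {G M A : Type*} [Group G] [Group M] [Monoid A]
    (φ : G →* MulAut M) (g : G) (χ : M →* A) :
    letI := characterAction (A := A) φ
    (g • χ).comp (φ g : M →* M) = χ :=
  MonoidHom.ext fun y => show χ (φ g⁻¹ (φ g y)) = χ y by simp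

/-- Evaluation of the `Kˣ`-valued characters of `M` at `y`, as an `L`-valued character of the dual
group of `M`. -/
def evalCharacter (K L : Type*) {M : Type*} [Field K] [Field L] [Algebra K L] [Group M] (y : M) :
    (M →* Kˣ) →* L :=
  (algebraMap K L : K →* L).comp ((Units.coeHom K).comp (MonoidHom.eval y))

/-- The Fourier transform `∑ c_y y ↦ (χ ↦ ∑ c_y χ(y))` of the group algebra `L[M]`, for
characters with values in `K`. -/
noncomputable def fourier (K L M : Type*) [Field K] [Field L] [Algebra K L] [Group M] :
    L[M] →ₐ[L] ((M →* Kˣ) → L) :=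
  AlgHom.pi fun χ => MonoidAlgebra.lift L L M
    ((algebraMap K L : K →* L).comp ((Units.coeHom K).comp χ))

section Fourier

variable {K L M : Type*} [Field K] [Field L] [Algebra K L]

section Group

variable [Group M]

theorem fourier_single (y : M) (c : L) (χ : M →* Kˣ) :
    fourier K L M (MonoidAlgebra.single y c) χ = c * algebraMap K L (χ y) := by
  simp [fourier]

theorem fourier_eq_linearCombination (a : L[M]) :
    fourier K L M a = Finsupp.linearCombination L
      (fun y : M => (evalCharacter K L y : (M →* Kˣ) → L)) (MonoidAlgebra.coeff a) := by
  induction a using MonoidAlgebra.induction_linear with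
  | zero => simp
  | add a b ha hb => simp [ha, hb]
  | single y c =>
    ext χ
    simp [fourier_single, evalCharacter]

theorem fourier_galAct (φ : Gal(L/K) →* MulAut M) (g : Gal(L/K)) (a : L[M]) (χ : M →* Kˣ) :
    fourier K L M (galAct K L φ g a) χ = g (fourier K L M a (χ.comp (φ g : M →* M))) := by
  induction a using MonoidAlgebra.induction_linear with
  | zero => simp
  | add a b ha hb => simp [ha, hb]
  | single y c => simp [galAct, fourier_single]

theorem mem_fixedPoints {φ : Gal(L/K) →* MulAut M} {a : L[M]} :
    a ∈ fixedPoints K L φ ↔ ∀ g, galAct K L φ g a = a := by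
  simp [fixedPoints, Algebra.mem_iInf, AlgHom.mem_equalizer]

end Group

variable [CommGroup M] [Finite M] [HasEnoughRootsOfUnity K (Monoid.exponent M)]

theorem evalCharacter_injective : Function.Injective (evalCharacter K L (M := M)) := by
  intro y z h
  refine (CommGroup.forall_apply_eq_apply_iff (M := K) M).mp fun χ => Units.ext ?_
  exact (algebraMap K L).injective (DFunLike.congr_fun h χ)

theorem fourier_injective : Function.Injective (fourier K L M) := by
  have h_indep : LinearIndependent L fun y : M => (evalCharacter K L y : (M →* Kˣ) → L) :=
    (linearIndependent_monoidHom (M →* Kˣ) L).comp _ evalCharacter_injective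
  intro a b hab
  rw [fourier_eq_linearCombination, fourier_eq_linearCombination] at hab
  exact MonoidAlgebra.coeff_injective (h_indep hab)

theorem fourier_surjective : Function.Surjective (fourier K L M) := by
  have := Fintype.ofFinite M
  have := Fintype.ofFinite (M →* Kˣ)
  have : Module.Finite L L[M] := Module.Finite.equiv (MonoidAlgebra.coeffLinearEquiv L).symm
  have finrank_eq : Module.finrank L L[M] = Module.finrank L ((M →* Kˣ) → L) := by
    rw [(MonoidAlgebra.coeffLinearEquiv L).finrank_eq, Module.finrank_finsupp_self,
      Module.finrank_fintype_fun_eq_card, ← Nat.card_eq_fintype_card, ← Nat.card_eq_fintype_card,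
      CommGroup.card_monoidHom_of_hasEnoughRootsOfUnity M K]
  exact (LinearMap.injective_iff_surjective_of_finrank_eq_finrank
    (f := (fourier K L M).toLinearMap) finrank_eq).mp fourier_injective

theorem mem_fixedPoints_iff_fourier_mem (φ : Gal(L/K) →* MulAut M) (a : L[M]) :
    letI := characterAction (A := Kˣ) φ
    a ∈ fixedPoints K L φ ↔ fourier K L M a ∈ equivariantFunctions K L (M →* Kˣ) := by
  let := characterAction (A := Kˣ) φ
  rw [mem_fixedPoints, mem_equivariantFunctions]
  refine forall_congr' fun g => ?_
  rw [← (fourier_injective (K := K)).eq_iff, funext_iff, (MulAction.surjective g).forall]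
  simp only [fourier_galAct, characterAction_smul_comp, eq_comm]

theorem map_fourier_fixedPoints (φ : Gal(L/K) →* MulAut M) :
    letI := characterAction (A := Kˣ) φ
    (fixedPoints K L φ).map ((fourier K L M).restrictScalars K) =
      equivariantFunctions K L (M →* Kˣ) := by
  let := characterAction (A := Kˣ) φ
  ext f
  obtain ⟨a, rfl⟩ := fourier_surjective f
  rw [← mem_fixedPoints_iff_fourier_mem]
  exact (fourier_injective (K := K) (L := L) (M := M)).mem_set_image

/-- The Fourier transform identifies `L[M]^G` with the `G`-equivariant functions on the dual
group of `M`. -/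
noncomputable def fixedPointsEquiv (φ : Gal(L/K) →* MulAut M) :
    letI := characterAction (A := Kˣ) φ
    fixedPoints K L φ ≃ₐ[K] equivariantFunctions K L (M →* Kˣ) :=
  letI := characterAction (A := Kˣ) φ
  ((fixedPoints K L φ).equivMapOfInjective ((fourier K L M).restrictScalars K)
    fourier_injective).trans (Subalgebra.equivOfEq _ _ (map_fourier_fixedPoints φ))

end Fourier

theorem mulAut_pow_apply_eq_zpow {M : Type*} [Group M] {ψ : MulAut M} {d : ℤ}
    (hψ : ∀ y, ψ y = y ^ d) (k : ℕ) (y : M) : (ψ ^ k) y = y ^ (d ^ k) := by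
  induction k with
  | zero => simp
  | succ k ih => rw [pow_succ', MulAut.mul_apply, ih, map_zpow, hψ, ← zpow_mul, pow_succ']

section Period

variable {G M A : Type*} [Group G] [Group M] [CommGroup A] {φ : G →* MulAut M} {σ : G} {d : ℤ}

theorem pow_smul_character_eq_iff (hφ : ∀ y, φ σ y = y ^ d) (χ : M →* A) (k : ℕ) :
    letI := characterAction (A := A) φ
    σ ^ k • χ = χ ↔ (orderOf χ : ℤ) ∣ d ^ k - 1 := by
  let := characterAction (A := A) φ
  have h_comp : χ.comp (φ (σ ^ k) : M →* M) = χ ^ (d ^ k) := by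
    ext y
    rw [MonoidHom.comp_apply, MonoidHom.coe_coe, map_pow, mulAut_pow_apply_eq_zpow hφ, map_zpow,
      MonoidHom.zpow_apply]
  rw [← MonoidHom.cancel_right (f := (φ (σ ^ k) : M →* M)) (φ (σ ^ k)).surjective,
    characterAction_smul_comp, h_comp, eq_comm, orderOf_dvd_iff_zpow_eq_one, zpow_sub_one,
    mul_inv_eq_one]

theorem period_character_eq_orderOf_pow (hφ : ∀ y, φ σ y = y ^ d) {χ : M →* A} {q : ℕ}
    (hd : ∀ k : ℕ, (orderOf χ : ℤ) ∣ d ^ k - 1 ↔ orderOf χ ∣ q * k) :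
    letI := characterAction (A := A) φ
    MulAction.period σ χ = orderOf (χ ^ q) := by
  let := characterAction (A := A) φ
  refine Nat.dvd_right_iff_eq.mp fun k => ?_
  rw [← MulAction.pow_smul_eq_iff_period_dvd, pow_smul_character_eq_iff hφ, hd,
    orderOf_dvd_iff_pow_eq_one, orderOf_dvd_iff_pow_eq_one, pow_mul]

end Period

section OrderCount

theorem orderOf_pow_prime_pow_eq_iff {X : Type*} [Monoid X] {p : ℕ} (hp : p.Prime) (x : X)
    (c j : ℕ) : orderOf (x ^ p ^ c) = p ^ (j + 1) ↔ orderOf x = p ^ (c + (j + 1)) := by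
  have := Fact.mk hp
  constructor
  · intro h
    refine orderOf_eq_prime_pow (n := c + j) ?_ ?_
    · rw [pow_add, pow_mul, ← orderOf_dvd_iff_pow_eq_one, h,
        Nat.pow_dvd_pow_iff_le_right hp.one_lt]
      exact Nat.not_succ_le_self j
    · rw [add_assoc, pow_add, pow_mul, ← h, pow_orderOf_eq_one]
  · intro h
    rw [orderOf_pow_of_dvd (pow_pos hp.pos c).ne' (h ▸ pow_dvd_pow p (Nat.le_add_right ..)), h,
      pow_add, Nat.mul_div_cancel_left _ (pow_pos hp.pos c)]

variable {X : Type*} [CommGroup X] [Finite X] [IsCyclic X]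

theorem card_orderOf_pow_eq_one {q : ℕ} (hq : q ∣ Nat.card X) :
    Nat.card {x : X // orderOf (x ^ q) = 1} = q := by
  simp only [orderOf_eq_one_iff]
  exact (IsCyclic.card_powMonoidHom_ker X q).trans (Nat.gcd_eq_right hq)

theorem card_orderOf_pow_eq_prime_pow {p c j : ℕ} (hp : p.Prime) (hj : 0 < j)
    (hX : p ^ (c + j) ∣ Nat.card X) :
    Nat.card {x : X // orderOf (x ^ p ^ c) = p ^ j} = (p ^ (c + j)).totient := by
  obtain ⟨j, rfl⟩ := Nat.exists_eq_add_of_le' hj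
  have := Fintype.ofFinite X
  simp only [orderOf_pow_prime_pow_eq_iff hp]
  rw [Nat.card_eq_fintype_card, Fintype.card_subtype]
  exact IsCyclic.card_orderOf_eq_totient (Nat.card_eq_fintype_card (α := X) ▸ hX)

end OrderCount

theorem nonempty_equivariantFunctions_algEquiv_prod_of_period_eq {K L X : Type*} [Field K]
    [Field L] [Algebra K L] [IsGalois K L] [CommGroup X] [IsCyclic X] [MulAction Gal(L/K) X]
    {σ : Gal(L/K)} (hσ : ∀ g : Gal(L/K), g ∈ Subgroup.zpowers σ) {p n v : ℕ} (hp : p.Prime)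
    (hv : 1 + v ≤ n) (hX : Nat.card X = p ^ n)
    (h_period : ∀ x : X, MulAction.period σ x = orderOf (x ^ p ^ (1 + v))) :
    Nonempty (equivariantFunctions K L X ≃ₐ[K]
      ((Fin (p ^ (1 + v)) → K) × ((m : Finset.Icc 1 (n - 1 - v)) →
          (Fin (p ^ v * (p - 1)) → tower p σ (m : ℕ))))) := by
  have : Finite X := Nat.finite_of_card_ne_zero (hX ▸ (pow_pos hp.pos n).ne')
  apply nonempty_equivariantFunctions_algEquiv_prod hσ hp.one_lt
  · intro x
    rw [h_period]
    refine (Nat.dvd_prime_pow hp).mp (orderOf_dvd_of_pow_eq_one ?_)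
    rw [← pow_mul, ← pow_add, show 1 + v + (n - 1 - v) = n by omega, ← hX, pow_card_eq_one']
  · simp only [h_period]
    exact card_orderOf_pow_eq_one (hX ▸ pow_dvd_pow p hv)
  · intro j hj
    obtain ⟨hj_pos, hj_le⟩ := Finset.mem_Icc.mp hj
    simp only [h_period]
    rw [card_orderOf_pow_eq_prime_pow hp hj_pos (hX ▸ pow_dvd_pow p (by omega)),
      Nat.totient_prime_pow hp (by omega), show 1 + v + j - 1 = v + j by omega, pow_add,
      mul_right_comm]

theorem nonempty_fixedPoints_algEquiv_prod {K L M : Type*} [Field K] [Field L] [Algebra K L]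
    [IsGalois K L] [CommGroup M] [IsCyclic M] {p n v : ℕ} (hp : p.Prime) (hv : 1 + v ≤ n)
    (hM : Nat.card M = p ^ n) (hK : ∃ ζ : K, IsPrimitiveRoot ζ (p ^ n)) {σ : Gal(L/K)}
    (hσ : ∀ g : Gal(L/K), g ∈ Subgroup.zpowers σ) (φ : Gal(L/K) →* MulAut M) {d : ℤ}
    (hφ : ∀ y, φ σ y = y ^ d)
    (hd : ∀ s ≤ n, ∀ k : ℕ, ((p ^ s : ℕ) : ℤ) ∣ d ^ k - 1 ↔ p ^ s ∣ p ^ (1 + v) * k) :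
    Nonempty (fixedPoints K L φ ≃ₐ[K]
      ((Fin (p ^ (1 + v)) → K) × ((m : Finset.Icc 1 (n - 1 - v)) →
          (Fin (p ^ v * (p - 1)) → tower p σ (m : ℕ))))) := by
  have : NeZero (p ^ n) := ⟨(pow_pos hp.pos n).ne'⟩
  have : Finite M := Nat.finite_of_card_ne_zero (hM ▸ NeZero.ne _)
  have : HasEnoughRootsOfUnity K (Nat.card M) := hM ▸ ⟨hK, rootsOfUnity.isCyclic K _⟩
  have : HasEnoughRootsOfUnity K (Monoid.exponent M) := by rwa [IsCyclic.exponent_eq_card]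
  obtain ⟨dual_equiv⟩ := IsCyclic.monoidHom_equiv_self M K
  have : IsCyclic (M →* Kˣ) := isCyclic_of_surjective dual_equiv.symm dual_equiv.symm.surjective
  have card_dual : Nat.card (M →* Kˣ) = p ^ n := (Nat.card_congr dual_equiv.toEquiv).trans hM
  let := characterAction (A := Kˣ) φ
  have period_eq (χ : M →* Kˣ) : MulAction.period σ χ = orderOf (χ ^ p ^ (1 + v)) := by
    obtain ⟨s, hs, h_order⟩ := (Nat.dvd_prime_pow hp).mp (card_dual ▸ orderOf_dvd_natCard χ)
    exact period_character_eq_orderOf_pow hφ (h_order ▸ hd s hs)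
  obtain ⟨e⟩ := nonempty_equivariantFunctions_algEquiv_prod_of_period_eq hσ hp hv card_dual
    period_eq
  exact ⟨(fixedPointsEquiv φ).trans e⟩

section Arithmetic

variable {p : ℕ}

theorem pow_add_dvd_pow_mul_pow_sub_one_iff (hp : p.Prime) (hp2 : p ≠ 2) {d : ℤ}
    (hd : (p : ℤ) ∣ d - 1) (s t k : ℕ) :
    ((p ^ (s + t) : ℕ) : ℤ) ∣ d ^ (k * p ^ t) - 1 ↔ ((p ^ s : ℕ) : ℤ) ∣ d ^ k - 1 := by
  have hp_int : Prime (p : ℤ) := Nat.prime_iff_prime_int.mp hp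
  have hpd : ¬(p : ℤ) ∣ d ^ k := fun h =>
    hp_int.not_dvd_one ((dvd_sub_right (hp_int.dvd_of_dvd_pow h)).mp hd)
  have hpk : (p : ℤ) ∣ d ^ k - 1 := hd.trans (sub_one_dvd_pow_sub_one d k)
  have h_lte := Int.emultiplicity_pow_sub_pow hp (hp.odd_of_ne_two hp2) hpk hpd (p ^ t)
  rw [one_pow, ← pow_mul, emultiplicity_pow_self hp.ne_zero hp.prime.not_isUnit] at h_lte
  rw [Nat.cast_pow, Nat.cast_pow, pow_dvd_iff_le_emultiplicity, pow_dvd_iff_le_emultiplicity,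
    h_lte, Nat.cast_add]
  exact ENat.add_le_add_iff_right (ENat.natCast_ne_top t)

theorem prime_pow_dvd_pow_sub_one_iff (hp : p.Prime) (hp2 : p ≠ 2) {d : ℤ}
    (hd : (p : ℤ) ∣ d - 1) {n q : ℕ} (h : ∀ k : ℕ, ((p ^ n : ℕ) : ℤ) ∣ d ^ k - 1 ↔ p ^ n ∣ q * k)
    {s : ℕ} (hs : s ≤ n) (k : ℕ) : ((p ^ s : ℕ) : ℤ) ∣ d ^ k - 1 ↔ p ^ s ∣ q * k := by
  obtain ⟨t, rfl⟩ := Nat.exists_eq_add_of_le hs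
  rw [← pow_add_dvd_pow_mul_pow_sub_one_iff hp hp2 hd s t, h, ← mul_assoc, pow_add,
    Nat.mul_dvd_mul_iff_right (pow_pos hp.pos t)]

theorem gcd_prime_pow_eq_pow_val {n r : ℕ} (hp : p.Prime) (hr : r < p ^ (n - 1)) :
    Nat.gcd r (p ^ (n - 1)) = p ^ val p n r := by
  have := Fact.mk hp
  rw [val]
  split_ifs with hr0
  · rw [hr0, Nat.gcd_zero_left]
  · obtain ⟨k, -, h_gcd⟩ := (Nat.dvd_prime_pow hp).mp (Nat.gcd_dvd_right r (p ^ (n - 1)))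
    have val_le : padicValNat p r ≤ n - 1 := ((Nat.pow_lt_pow_iff_right hp.one_lt).mp
      ((Nat.le_of_dvd (Nat.pos_of_ne_zero hr0) pow_padicValNat_dvd).trans_lt hr)).le
    apply Nat.dvd_antisymm
    · rw [h_gcd]
      exact pow_dvd_pow p ((padicValNat_dvd_iff_le hr0).mp (h_gcd ▸ Nat.gcd_dvd_left ..))
    · exact Nat.dvd_gcd pow_padicValNat_dvd (pow_dvd_pow p val_le)

end Arithmetic

section CyclicGroup

variable {N : Type*} [Group N]

theorem mulAut_apply_eq_zpow_of_generator {η : N} (hη : ∀ x : N, x ∈ Subgroup.zpowers η)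
    {ψ : MulAut N} {d : ℤ} (hψ : ψ η = η ^ d) (x : N) : ψ x = x ^ d := by
  obtain ⟨a, rfl⟩ := Subgroup.mem_zpowers_iff.mp (hη x)
  rw [map_zpow, hψ, zpow_comm]

variable [IsCyclic N]

theorem mulAut_pow_eq_one_iff {ψ : MulAut N} {d : ℤ} (hψ : ∀ x, ψ x = x ^ d) (k : ℕ) :
    ψ ^ k = 1 ↔ (Nat.card N : ℤ) ∣ d ^ k - 1 := by
  rw [← IsCyclic.exponent_eq_card, Group.exponent_dvd_iff_forall_zpow_eq_one, MulEquiv.ext_iff]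
  refine forall_congr' fun x => ?_
  rw [mulAut_pow_apply_eq_zpow hψ, MulAut.one_apply, zpow_sub_one, mul_inv_eq_one]

theorem orderOf_of_forall_mem_zpowers_mulAut {p n : ℕ} (hp : p.Prime) (hn : 1 ≤ n)
    (hN : Nat.card N = p ^ n) {θ : MulAut N} (hθ : ∀ ψ : MulAut N, ψ ∈ Subgroup.zpowers θ) :
    orderOf θ = (p - 1) * p ^ (n - 1) := by
  have : Finite N := Nat.finite_of_card_ne_zero (hN ▸ (pow_pos hp.pos n).ne')
  rw [orderOf_eq_card_of_forall_mem_zpowers hθ, IsCyclic.card_mulAut, hN,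
    Nat.totient_prime_pow hp hn, mul_comm]

end CyclicGroup

theorem pow_sub_one_pow_pow_eq_one_iff {A : Type*} [Monoid A] {p n r v : ℕ} (hp : p.Prime)
    (hn : 1 ≤ n) {θ : A} (hθ : orderOf θ = (p - 1) * p ^ (n - 1))
    (hv : Nat.gcd r (p ^ (n - 1)) = p ^ v) (k : ℕ) :
    ((θ ^ (p - 1)) ^ r) ^ k = 1 ↔ p ^ n ∣ p ^ (1 + v) * k := by
  calc ((θ ^ (p - 1)) ^ r) ^ k = 1
      ↔ p ^ (n - 1) ∣ r * k := by
        rw [← pow_mul, ← pow_mul, ← orderOf_dvd_iff_pow_eq_one, hθ,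
          Nat.mul_dvd_mul_iff_left (Nat.sub_pos_of_lt hp.one_lt)]
    _ ↔ p ^ (n - 1) ∣ p ^ v * k := by rw [← hv, Nat.gcd_comm, Nat.dvd_gcd_mul_iff_dvd_mul]
    _ ↔ p ^ n ∣ p ^ (1 + v) * k := by
        rw [← Nat.mul_dvd_mul_iff_left hp.pos, ← mul_assoc, ← pow_succ', ← pow_succ',
          Nat.sub_add_cancel hn, add_comm v]

section Translation

variable {G N : Type*} [Group G] [Group N] (β : G →* Hol N)
  (hβ : Function.Bijective fun g : G => (β g : Equiv.Perm N) 1)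

theorem translate_injective : Function.Injective (translate β hβ) := by
  refine (orbitEquiv β hβ).symm.permCongrHom.injective.comp fun a b h => ?_
  simpa [lam] using DFunLike.congr_fun h 1

theorem lam_mul_translate_mul_inv {g : G} {y : N} {ψ : MulAut N} (hg : β g = holElt y ψ) (x : N) :
    lam G g * translate β hβ x * (lam G g)⁻¹ = translate β hβ (ψ x) := by
  have orbitEquiv_mul (h : G) : orbitEquiv β hβ (g * h) = ψ (orbitEquiv β hβ h) * y⁻¹ := by
    rw [← holElt_apply, ← hg]
    simp [orbitEquiv]
  rw [mul_inv_eq_iff_eq_mul]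
  ext h
  apply (orbitEquiv β hβ).injective
  simp [lam, translate, Equiv.permCongrHom, Equiv.permCongr_apply, orbitEquiv_mul, mul_assoc]

theorem conjAct_apply_eq_zpow {g : G} {y : N} {ψ : MulAut N} (hg : β g = holElt y ψ) {d : ℤ}
    (hψ : ∀ x, ψ x = x ^ d) (π : (translate β hβ).range) :
    conjAct (translate β hβ).range (translate_stable β hβ) g π = π ^ d := by
  obtain ⟨_, x, rfl⟩ := π
  refine Subtype.ext ((lam_mul_translate_mul_inv β hβ hg x).trans ?_)
  rw [hψ, map_zpow, Subgroup.coe_zpow]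

end Translation

end CyclicHopfGalois

open CyclicHopfGalois in
theorem mainTheorem10_general {K L N : Type*} [Field K] [Field L] [Algebra K L] [IsGalois K L]
    [Group N] {p n v : ℕ} (hp : p.Prime) (hp2 : p ≠ 2) (hn : 1 ≤ n)
    (hK : ∃ ζ : K, IsPrimitiveRoot ζ (p ^ n)) {σ : Gal(L/K)}
    (hσ : ∀ g : Gal(L/K), g ∈ Subgroup.zpowers σ) (hG : Nat.card Gal(L/K) = p ^ n)
    {η : N} (hη : ∀ x : N, x ∈ Subgroup.zpowers η) (hN : Nat.card N = p ^ n)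
    {θ : MulAut N} (hθ : ∀ φ : MulAut N, φ ∈ Subgroup.zpowers θ)
    {r : ℕ} (hv : Nat.gcd r (p ^ (n - 1)) = p ^ v) :
    Nonempty (hopfAlgCyclic K L hp hp2 hn hσ hG hη hN θ r ≃ₐ[K]
      ((Fin (p ^ (1 + v)) → K) × ((m : Finset.Icc 1 (n - 1 - v)) →
          (Fin (p ^ v * (p - 1)) → tower p σ (m : ℕ))))) := by
  have : IsCyclic N := ⟨η, hη⟩
  have hvn : 1 + v ≤ n := by
    have := (Nat.pow_dvd_pow_iff_le_right hp.one_lt).mp (hv ▸ Nat.gcd_dvd_right r (p ^ (n - 1)))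
    omega
  obtain ⟨d, hpd, hd⟩ := aut_pow_gen hp hn hη hN θ r
  have hψ (x : N) : ((θ ^ (p - 1)) ^ r) x = x ^ d := mulAut_apply_eq_zpow_of_generator hη hd x
  have h_pow (k : ℕ) : ((p ^ n : ℕ) : ℤ) ∣ d ^ k - 1 ↔ p ^ n ∣ p ^ (1 + v) * k := by
    rw [← hN, ← mulAut_pow_eq_one_iff hψ, hN]
    exact pow_sub_one_pow_pow_eq_one_iff hp hn
      (orderOf_of_forall_mem_zpowers_mulAut hp hn hN hθ) hv k
  let M := (alpha hp hp2 hn hσ hG hη hN θ r).range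
  let e : N ≃* M :=
    MonoidHom.ofInjective (translate_injective _ (beta_regular hp hp2 hn hσ hG hη hN θ r))
  have : IsCyclic M := isCyclic_of_surjective e e.surjective
  let : CommGroup M := IsCyclic.commGroup
  exact nonempty_fixedPoints_algEquiv_prod (M := M) hp hvn
    ((Nat.card_congr e.symm.toEquiv).trans hN) hK hσ _
    (conjAct_apply_eq_zpow _ _ (beta_gen hp hp2 hn hσ hG hη hN θ r) hψ)
    fun s hs k => prime_pow_dvd_pow_sub_one_iff hp hp2 hpd h_pow hs k

theorem mainTheorem10 {K L N : Type*} [Field K] [CharZero K] [Field L] [Algebra K L]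
    [FiniteDimensional K L] [IsGalois K L] [Group N]
    {p n : ℕ} (hp : p.Prime) (hp2 : p ≠ 2) (hn : 1 ≤ n)
    (hL : Module.finrank K L = p ^ n)
    (hK : ∃ ζ : K, IsPrimitiveRoot ζ (p ^ n))
    {σ : Gal(L/K)} (hσ : ∀ g : Gal(L/K), g ∈ Subgroup.zpowers σ)
    {η : N} (hη : ∀ x : N, x ∈ Subgroup.zpowers η) (hN : Nat.card N = p ^ n)
    {θ : MulAut N} (hθ : ∀ φ : MulAut N, φ ∈ Subgroup.zpowers θ)
    {r : ℕ} (hr : r < p ^ (n - 1)) :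
    Nonempty
      (CyclicHopfGalois.hopfAlgCyclic K L hp hp2 hn hσ ((IsGalois.card_aut_eq_finrank K L).trans hL) hη hN θ r
        ≃ₐ[K]
      ((Fin (p ^ (1 + CyclicHopfGalois.val p n r)) → K) ×
        ((m : Finset.Icc 1 (n - 1 - CyclicHopfGalois.val p n r)) →
          (Fin (p ^ CyclicHopfGalois.val p n r * (p - 1)) → CyclicHopfGalois.tower p σ (m : ℕ))))) := by
  exact mainTheorem10_general hp hp2 hn hK hσ _ hη hN hθ
    (CyclicHopfGalois.gcd_prime_pow_eq_pow_val hp hr)
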